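/- Let $p\ge 5$ be a prime, let $G$ be a finite rational $2$-group (rational means that, for every $g\in G$, every generator of the cyclic group $\langle g\rangle$ is conjugate to $g$ in $G$), and let $V$ be a non-zero simple $\mathbb F_pG$-module with the eigenvector property, that is, for every $v\in V$ and every $\lambda\in\mathbb F_p\setminus\{0\}$ there is some $g\in G$ that maps $v$ to $\lambda v$. Then $p=5$, and there is a subspace $W$ of $V$ such that, with $$N=N_G(W)=\{g\in G: g \text{ maps } W \text{ onto } W\},\qquad C=C_G(W)=\{g\in G: g\text{ fixes every element of } W\},$$ we have $$W\rtimes (N/C)\;\cong\;\mathfrak M \text{ as groups}\qquad\text{and}\qquad V\;\cong\;\operatorname{Ind}_N^G(W)\text{ as } \mathbb F_pG\text{-modules}.$$ Here the semidirect product is formed with respect to the action of $N/C$ on the additive group of $W$ induced by that of $G$ on $V$, $\operatorname{Ind}_N^G$ is induction of modules from $N$ to $G$, and $\mathfrak M$ is the Frobenius group $C_5^2\rtimes Q_8$ in which the quaternion group $Q_8$ of order $8$ acts on $C_5^2=\mathbb F_5^2$ as a subgroup of $\mathrm{SL}(2,5)$. -/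

import Mathlib

/-- A group `G` is rational if, for every `g : G`, every generator `h` of the cyclic
subgroup `⟨g⟩` is conjugate to `g`. -/
def IsRationalGroup (G : Type*) [Group G] : Prop :=
  ∀ g h : G, Subgroup.zpowers h = Subgroup.zpowers g → IsConj g h

namespace RatTwo

variable {k G V : Type*} [CommRing k] [Group G] [AddCommGroup V] [Module k V]

/-- The eigenvector property: for every vector `v` and every nonzero scalar `c` some group
element maps `v` to `c • v`. -/
def HasEigenvectorProperty {F G V : Type*} [Field F] [Group G] [AddCommGroup V] [Module F V]
    (ρ : Representation F G V) : Prop :=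
  ∀ (v : V) (c : F), c ≠ 0 → ∃ g : G, ρ g v = c • v

/-- `N_G(W)`: the group elements that map the subspace `W` onto itself. -/
def normalizer (ρ : Representation k G V) (W : Submodule k V) : Subgroup G where
  carrier := {g | W.map (ρ g) = W}
  mul_mem' := by
    intro a b ha hb
    simp only [Set.mem_ofPred_eq] at *
    rw [map_mul, Module.End.mul_eq_comp, Submodule.map_comp, hb, ha]
  one_mem' := by
    simp [Module.End.one_eq_id]
  inv_mem' := by
    intro a ha
    simp only [Set.mem_ofPred_eq] at *
    conv_lhs => rw [← ha]
    rw [← Submodule.map_comp, ← Module.End.mul_eq_comp, ← map_mul, inv_mul_cancel, map_one,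
      Module.End.one_eq_id, Submodule.map_id]

/-- `C_G(A)`: the group elements that fix every element of the subset `A` of `V`. -/
def centralizer (ρ : Representation k G V) (A : Set V) : Subgroup G where
  carrier := {g | ∀ a ∈ A, ρ g a = a}
  mul_mem' := by
    intro a b ha hb v hv
    rw [map_mul, Module.End.mul_apply, hb v hv, ha v hv]
  one_mem' := by
    intro v _
    simp
  inv_mem' := by
    intro a ha v hv
    conv_lhs => rw [← ha v hv]
    rw [← Module.End.mul_apply, ← map_mul, inv_mul_cancel, map_one, Module.End.one_apply]

theorem apply_mem_of_mem_normalizer (ρ : Representation k G V) (W : Submodule k V)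
    (g : normalizer ρ W) (w : V) (hw : w ∈ W) : ρ (g : G) w ∈ W := by
  have h : W.map (ρ (g : G)) = W := g.2
  exact h.le (Submodule.mem_map_of_mem hw)

/-- `W` as a module over `N_G(W)`. -/
def normalizerRep (ρ : Representation k G V) (W : Submodule k V) :
    Representation k (normalizer ρ W) W where
  toFun g := (ρ (g : G)).restrict (apply_mem_of_mem_normalizer ρ W g)
  map_one' := by
    ext w
    simp
  map_mul' := by
    intro a b
    ext w
    simp

/-- The subgroup `C_G(W)`, seen inside `N_G(W)`. -/
def centralizerInNormalizer (ρ : Representation k G V) (W : Submodule k V) :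
    Subgroup (normalizer ρ W) :=
  (centralizer ρ (W : Set V)).subgroupOf (normalizer ρ W)

theorem centralizer_le_normalizer (ρ : Representation k G V) (W : Submodule k V) :
    centralizer ρ (W : Set V) ≤ normalizer ρ W := by
  intro g hg
  change W.map (ρ g) = W
  ext v
  constructor
  · rintro ⟨w, hw, rfl⟩
    rw [hg w hw]
    exact hw
  · intro hv
    exact ⟨v, hv, hg v hv⟩

theorem mem_centralizerInNormalizer (ρ : Representation k G V) (W : Submodule k V)
    (g : normalizer ρ W) :
    g ∈ centralizerInNormalizer ρ W ↔ normalizerRep ρ W g = 1 := by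
  rw [centralizerInNormalizer, Subgroup.mem_subgroupOf]
  constructor
  · intro h
    ext w
    exact h w w.2
  · intro h w hw
    have := congrArg Subtype.val (LinearMap.congr_fun h ⟨w, hw⟩)
    exact this

instance centralizerInNormalizer_normal (ρ : Representation k G V) (W : Submodule k V) :
    (centralizerInNormalizer ρ W).Normal where
  conj_mem := by
    intro n hn g
    rw [mem_centralizerInNormalizer] at hn ⊢
    rw [map_mul, map_mul, hn, mul_one, ← map_mul, mul_inv_cancel, map_one]

/-- `W` as a module over `N_G(W) / C_G(W)`. -/
def quotientRep (ρ : Representation k G V) (W : Submodule k V) :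
    Representation k (normalizer ρ W ⧸ centralizerInNormalizer ρ W) W :=
  QuotientGroup.lift (centralizerInNormalizer ρ W) (normalizerRep ρ W)
    (fun g hg => (mem_centralizerInNormalizer ρ W g).1 hg)

/-- A linear action of `G` on `V`, seen as an action by automorphisms on the additive group
of `V` (written multiplicatively). -/
def toMulAut (ρ : Representation k G V) : G →* MulAut (Multiplicative V) where
  toFun g :=
    { toFun := fun v => Multiplicative.ofAdd (ρ g v.toAdd)
      invFun := fun v => Multiplicative.ofAdd (ρ g⁻¹ v.toAdd)
      left_inv := by
        intro v
        simp
      right_inv := by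
        intro v
        simp
      map_mul' := by
        intro v w
        simp }
  map_one' := by
    ext v
    simp
  map_mul' := by
    intro a b
    ext v
    simp

/-- The semidirect product `V ⋊ G` of the module `V` by the group `G` acting on it. -/
abbrev ModuleSemidirect (ρ : Representation k G V) : Type _ :=
  SemidirectProduct (Multiplicative V) G (toMulAut ρ)

/-- The element `diag(2, 3)` of `SL(2, 5)`, of order `4`. -/
def matI : Matrix.SpecialLinearGroup (Fin 2) (ZMod 5) :=
  ⟨!![2, 0; 0, 3], by decide⟩

/-- The element of `SL(2, 5)` with rows `(0, 1)` and `(-1, 0)`. -/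
def matJ : Matrix.SpecialLinearGroup (Fin 2) (ZMod 5) :=
  ⟨!![0, 1; -1, 0], by decide⟩

/-- The embedding of the quaternion group `Q₈` (`QuaternionGroup 2` in Mathlib, with elements
`a i` and `xa i` for `i : ZMod 4`) into `SL(2, 5)`, sending `a i` to `matI ^ i` and `xa i` to
`matJ * matI ^ i`. -/
def quaternionToSL : QuaternionGroup 2 →* Matrix.SpecialLinearGroup (Fin 2) (ZMod 5) where
  toFun
    | .a i => matI ^ (i : ZMod 4).val
    | .xa i => matJ * matI ^ (i : ZMod 4).val
  map_one' := by decide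
  map_mul' := by decide

theorem quaternionToSL_injective : Function.Injective quaternionToSL := by
  decide

/-- The `2`-dimensional module over the field with five elements on which `Q₈` acts as a
subgroup of `SL(2, 5)`. -/
def quaternionRep : Representation (ZMod 5) (QuaternionGroup 2) (Fin 2 → ZMod 5) where
  toFun q := Matrix.toLin' (quaternionToSL q).1
  map_one' := by simp [Module.End.one_eq_id]
  map_mul' := by
    intro a b
    simp [Matrix.toLin'_mul, Module.End.mul_eq_comp]

/-- The group `𝔐`: the Frobenius group `C₅² ⋊ Q₈` with `Q₈` acting on `C₅²` as a subgroup of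
`SL(2, 5)`. -/
abbrev GroupM : Type := ModuleSemidirect quaternionRep

end RatTwo

/-!
# Rational 2-groups with the eigenvector property

Every element of a rational group is conjugate to its inverse, so `V` and its dual have the same
character. The degree of an irreducible representation of a `2`-group is a power of two, hence
prime to `p`, and the inner product formula for characters then yields a nonzero `G`-invariant
bilinear form `B` on `V` (`exists_invariant_form`). From here on rationality is not needed: the
existence of `B`, unlike rationality, can be passed on to subgroups.

The form forces every scalar in the image of `G` to be `1` or `-1`. Since some element has an
eigenvalue `i` with `i ^ 2 = -1`, the image is larger than `{1, -1}`, and an element `b` of the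
image that has order two modulo `{1, -1}` and is central there is not a scalar. It has two
eigenspaces, permuted by `G`, so `V = U ⊕ ρ t U` where the stabilizer `M` of `U` has index two
(`exists_normalizer_index_eq_two`). If `B` does not vanish on `U × U`, then `M` acting on `U`
satisfies the same hypotheses and induction applies. Suppose that `U`, and so also `ρ t U`, is
totally isotropic. For `a ∈ U` and `b ∈ ρ t U` with `B a b ≠ 0`, an element multiplying `a + b` by
`c`, where `c ^ 2 ≠ 1`, must interchange the two summands (`exists_swap`), because otherwise
`B a b = c ^ 2 * B a b`. Consequently `M` is transitive on the nonzero vectors of `U`, so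
`|U| - 1` is a power of two, which leaves only `dim U = 1`. Comparing the swaps for `c = i` and
`c = 2` gives `5 = 0` in the field, and the action on the plane `V` can be read off: it is that of
the quaternion group (`exists_isQuaternionPair_of_finrank_eq_one`).

The plane `W` found at the end of the induction satisfies `dim V = |G : N_G(W)| * dim W`. By
irreducibility the natural map from the induced module to `V` is onto, so it is an isomorphism.
-/

namespace RatTwo
open Module

/-! ### Irreducible representations and subgroups of index two -/

section Irreducible

variable {k G V : Type*} [Field k] [Group G] [AddCommGroup V] [Module k V]
  {ρ : Representation k G V}

theorem eq_bot_or_eq_top_of_isIrreducible (h : ρ.IsIrreducible) (W : Submodule k V)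
    (hW : ∀ g, ∀ w ∈ W, ρ g w ∈ W) : W = ⊥ ∨ W = ⊤ := by
  have := h.eq_bot_or_eq_top ⟨W, fun g w hw => hW g w hw⟩
  rcases this with h | h
  · exact Or.inl (congrArg Subrepresentation.toSubmodule h)
  · exact Or.inr (congrArg Subrepresentation.toSubmodule h)

theorem nontrivial_of_isIrreducible (h : ρ.IsIrreducible) : Nontrivial V := by
  by_contra hV
  rw [not_nontrivial_iff_subsingleton] at hV
  obtain ⟨A, B, hAB⟩ := h.toNontrivial
  exact hAB (Subrepresentation.toSubmodule_injective (Subsingleton.elim _ _))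

theorem isIrreducible_of_forall_submodule [Nontrivial V]
    (h : ∀ W : Submodule k V, (∀ g, ∀ w ∈ W, ρ g w ∈ W) → W = ⊥ ∨ W = ⊤) :
    ρ.IsIrreducible where
  exists_pair_ne := ⟨⊥, ⊤, fun e => bot_ne_top (congrArg Subrepresentation.toSubmodule e)⟩
  eq_bot_or_eq_top A := by
    rcases h A.toSubmodule (fun g w hw => A.apply_mem_toSubmodule g hw) with h | h
    · exact Or.inl (Subrepresentation.toSubmodule_injective h)
    · exact Or.inr (Subrepresentation.toSubmodule_injective h)

theorem finiteDimensional_of_isIrreducible [Finite G] (h : ρ.IsIrreducible) :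
    FiniteDimensional k V := by
  have := nontrivial_of_isIrreducible h
  obtain ⟨v, hv⟩ := exists_ne (0 : V)
  have key : Submodule.span k (Set.range fun g => ρ g v) = ⊤ := by
    refine (eq_bot_or_eq_top_of_isIrreducible h _ ?_).resolve_left ?_
    · intro g w hw
      have hle : Submodule.span k (Set.range fun g => ρ g v) ≤
          (Submodule.span k (Set.range fun g => ρ g v)).comap (ρ g) := by
        rw [Submodule.span_le]
        rintro _ ⟨x, rfl⟩
        exact Submodule.subset_span ⟨g * x, by simp⟩
      exact hle hw
    · intro hb
      rw [Submodule.span_eq_bot] at hb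
      exact hv (by simpa using hb (ρ 1 v) ⟨1, rfl⟩)
  exact Module.finite_def.2 (key ▸ Submodule.fg_span (Set.finite_range _))

/-- Over a subgroup of index two, an invariant subspace `U` and its translate by an element
outside the subgroup are permuted by the whole group. -/
theorem apply_mem_translate_of_index_two {M : Subgroup G} (hM : M.index = 2) {t : G} (ht : t ∉ M)
    {U : Submodule k V} (hU : ∀ g ∈ M, ∀ u ∈ U, ρ g u ∈ U) (g : G) :
    (g ∈ M → ∀ u ∈ U.map (ρ t), ρ g u ∈ U.map (ρ t)) ∧
    (g ∉ M → (∀ u ∈ U, ρ g u ∈ U.map (ρ t)) ∧ ∀ u ∈ U.map (ρ t), ρ g u ∈ U) := by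
  have hn : M.Normal := Subgroup.normal_of_index_eq_two hM
  refine ⟨?_, fun hg => ⟨?_, ?_⟩⟩
  · rintro hg _ ⟨u, hu, rfl⟩
    refine ⟨ρ (t⁻¹ * g * t) u, hU _ ?_ u hu, ?_⟩
    · simpa using hn.conj_mem g hg t⁻¹
    · simp only [← Module.End.mul_apply, ← map_mul]
      congr 2
      group
  · intro u hu
    refine ⟨ρ (t⁻¹ * g) u, hU _ ?_ u hu, ?_⟩
    · rw [Subgroup.mul_mem_iff_of_index_two hM]
      simp [ht, hg]
    · simp only [← Module.End.mul_apply, ← map_mul]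
      simp
  · rintro _ ⟨u, hu, rfl⟩
    rw [← Module.End.mul_apply, ← map_mul]
    refine hU _ ?_ u hu
    rw [Subgroup.mul_mem_iff_of_index_two hM]
    simp [ht, hg]

theorem sup_translate_eq_top (h : ρ.IsIrreducible) {M : Subgroup G} (hM : M.index = 2) {t : G}
    (ht : t ∉ M) {U : Submodule k V} (hU : ∀ g ∈ M, ∀ u ∈ U, ρ g u ∈ U) (h0 : U ≠ ⊥) :
    U ⊔ U.map (ρ t) = ⊤ := by
  refine (eq_bot_or_eq_top_of_isIrreducible h _ ?_).resolve_left
    (fun e => h0 (eq_bot_iff.2 (e ▸ le_sup_left)))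
  intro g w hw
  obtain ⟨u, hu, u', hu', rfl⟩ := Submodule.mem_sup.1 hw
  rw [map_add]
  have key := apply_mem_translate_of_index_two hM ht hU g
  by_cases hg : g ∈ M
  · exact add_mem (Submodule.mem_sup_left (hU g hg u hu))
      (Submodule.mem_sup_right (key.1 hg u' hu'))
  · exact add_mem (Submodule.mem_sup_right ((key.2 hg).1 u hu))
      (Submodule.mem_sup_left ((key.2 hg).2 u' hu'))

theorem inf_translate_eq_bot_or_eq_top (h : ρ.IsIrreducible) {M : Subgroup G} (hM : M.index = 2)
    {t : G} (ht : t ∉ M) {U : Submodule k V} (hU : ∀ g ∈ M, ∀ u ∈ U, ρ g u ∈ U) :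
    U ⊓ U.map (ρ t) = ⊥ ∨ U ⊓ U.map (ρ t) = ⊤ := by
  refine eq_bot_or_eq_top_of_isIrreducible h _ ?_
  rintro g w ⟨hw, hw'⟩
  have key := apply_mem_translate_of_index_two hM ht hU g
  by_cases hg : g ∈ M
  · exact ⟨hU g hg w hw, key.1 hg w hw'⟩
  · exact ⟨(key.2 hg).2 w hw', (key.2 hg).1 w hw⟩

theorem finrank_map_apply (ρ : Representation k G V) (g : G) (U : Submodule k V) :
    finrank k (U.map (ρ g)) = finrank k U := by
  exact (Submodule.equivMapOfInjective (ρ g) (ρ.apply_bijective g).1 U).finrank_eq.symm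

theorem exists_index_eq_two [Finite G] [Nontrivial G] (hG : IsPGroup 2 G) :
    ∃ M : Subgroup G, M.index = 2 := by
  obtain ⟨n, hn, hc⟩ := hG.nontrivial_iff_card.1 inferInstance
  obtain ⟨m, rfl⟩ : ∃ m, n = m + 1 := ⟨n - 1, by omega⟩
  obtain ⟨M, hM⟩ := Sylow.exists_subgroup_card_pow_prime (G := G) 2 (n := m)
    (hc ▸ pow_dvd_pow 2 (Nat.le_succ m))
  refine ⟨M, ?_⟩
  have := M.card_mul_index
  rw [hM, hc, pow_succ] at this
  exact Nat.eq_of_mul_eq_mul_left (by positivity) this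

/-- By Clifford theory for a subgroup of index two, the degree either stays the same or doubles
at each step of a chain of subgroups of index two. -/
theorem exists_finrank_eq_two_pow {k : Type*} [Field k] {n : ℕ} :
    ∀ {G V : Type*} [Group G] [Finite G] [AddCommGroup V] [Module k V]
      {ρ : Representation k G V}, IsPGroup 2 G → ρ.IsIrreducible → Nat.card G = n →
      ∃ m, finrank k V = 2 ^ m := by
  induction n using Nat.strong_induction_on with
  | _ n ih =>
  intro G V _ _ _ _ ρ hG h hn
  have hfd := finiteDimensional_of_isIrreducible h
  have hV := nontrivial_of_isIrreducible h
  rcases subsingleton_or_nontrivial G with hs | hs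
  · refine ⟨0, ?_⟩
    obtain ⟨v, hv⟩ := exists_ne (0 : V)
    have : Submodule.span k {v} = ⊤ := by
      refine (eq_bot_or_eq_top_of_isIrreducible h _ ?_).resolve_left (by simpa using hv)
      intro g w hw
      rw [Subsingleton.elim g 1]
      simpa using hw
    rw [pow_zero, ← finrank_top k V, ← this, finrank_span_singleton hv]
  · obtain ⟨M, hM⟩ := exists_index_eq_two hG
    obtain ⟨t, ht⟩ : ∃ t, t ∉ M := by
      by_contra! hc
      rw [(Subgroup.eq_top_iff' M).2 hc, Subgroup.index_top] at hM
      omega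
    -- A nonzero `M`-invariant subspace `U` of least dimension is irreducible over `M`.
    let P : ℕ → Prop := fun d => ∃ U : Submodule k V, (∀ g ∈ M, ∀ u ∈ U, ρ g u ∈ U) ∧ U ≠ ⊥ ∧
      finrank k U = d
    have hP : ∃ d, P d := ⟨_, ⊤, by simp, top_ne_bot, rfl⟩
    classical
    obtain ⟨U, hU, hU0, hUd⟩ := Nat.find_spec hP
    have hUn : Nontrivial U := (Submodule.nontrivial_iff_ne_bot).2 hU0
    let σ : Representation k M U :=
      Representation.subrepresentation (ρ.comp M.subtype) U (fun g u hu => hU g g.2 u hu)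
    have hσ : σ.IsIrreducible := by
      refine isIrreducible_of_forall_submodule fun W hW => ?_
      by_contra! hc
      have hWV : W.map U.subtype ≠ ⊥ := fun e =>
        hc.1 (Submodule.map_injective_of_injective U.injective_subtype (e.trans (Submodule.map_bot _).symm))
      have hlt : finrank k (W.map U.subtype) < finrank k U := by
        rw [Submodule.finrank_map_subtype_eq]
        exact Submodule.finrank_lt hc.2
      refine Nat.find_min hP (hUd ▸ hlt) ⟨W.map U.subtype, ?_, hWV, rfl⟩
      rintro g hg _ ⟨w, hw, rfl⟩
      exact ⟨σ ⟨g, hg⟩ w, hW _ w hw, rfl⟩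
    have hcard : Nat.card M < n := by
      have := M.card_mul_index
      have h0 : 0 < Nat.card M := Nat.card_pos
      rw [hM, hn] at this
      omega
    obtain ⟨m, hm⟩ := ih _ hcard (hG.to_subgroup M) hσ rfl
    have hsup := sup_translate_eq_top h hM ht hU hU0
    have hdim := Submodule.finrank_sup_add_finrank_inf_eq U (U.map (ρ t))
    rw [hsup, finrank_top, finrank_map_apply] at hdim
    rcases inf_translate_eq_bot_or_eq_top h hM ht hU with hi | hi
    · rw [hi, finrank_bot, hm] at hdim
      exact ⟨m + 1, by omega⟩
    · rw [hi, finrank_top, hm] at hdim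
      exact ⟨m, by omega⟩

end Irreducible

/-! ### Invariant forms from real conjugacy classes -/

section SelfDual

variable {k G V : Type*} [Field k] [Group G] [AddCommGroup V] [Module k V]
  {ρ : Representation k G V}

open scoped MonoidAlgebra in
/-- By Schur's lemma `V` is a vector space over its endomorphism algebra. -/
theorem finrank_intertwiningMap_dvd_finrank (h : ρ.IsIrreducible) :
    finrank k (Representation.IntertwiningMap ρ ρ) ∣ finrank k V := by
  classical
  have hs : IsSimpleModule k[G] ρ.asModule :=
    (Representation.irreducible_iff_isSimpleModule_asModule ρ).1 h
  have h1 := (Representation.IntertwiningMap.equivAlgEnd (ρ := ρ)).toLinearEquiv.finrank_eq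
  rw [h1]
  let := Module.End.instDivisionRing (R := k[G]) (M := ρ.asModule)
  have := Module.finrank_mul_finrank k (Module.End k[G] ρ.asModule) ρ.asModule
  exact ⟨_, this.symm⟩

/-- If every element is conjugate to its inverse, the representation and its dual have the same
character, so the dimension of `Hom(V, V*)` agrees in `k` with that of `End V`, which is nonzero in
`k` because it divides the degree. -/
theorem exists_invariant_form [Finite G] (h : ρ.IsIrreducible)
    (hG : (Nat.card G : k) ≠ 0) (hV : (finrank k V : k) ≠ 0)
    (hconj : ∀ g : G, IsConj g g⁻¹) :
    ∃ B : V →ₗ[k] Dual k V, B ≠ 0 ∧ ∀ g v w, B (ρ g v) (ρ g w) = B v w := by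
  have := finiteDimensional_of_isIrreducible h
  have := Fintype.ofFinite G
  have := invertibleOfNonzero hG
  have h1 := Representation.card_inv_mul_sum_char_mul_char_eq_finrank ρ ρ
  have h2 := Representation.card_inv_mul_sum_char_mul_char_eq_finrank ρ ρ.dual
  have h3 : ∀ g, ρ.dual.character g = ρ.character g := by
    intro g
    obtain ⟨c, hc⟩ := isConj_iff.1 (hconj g)
    rw [Representation.char_dual, ← hc, Representation.char_conj]
  simp only [h3, h1] at h2
  obtain ⟨c, hc⟩ := finrank_intertwiningMap_dvd_finrank h
  have h4 : finrank k (Representation.IntertwiningMap ρ ρ.dual) ≠ 0 := by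
    intro h0
    rw [h0, Nat.cast_zero] at h2
    rw [hc, Nat.cast_mul, h2, zero_mul] at hV
    exact hV rfl
  have := nontrivial_of_finrank_pos (Nat.pos_of_ne_zero h4)
  obtain ⟨f, hf⟩ := exists_ne (0 : Representation.IntertwiningMap ρ ρ.dual)
  refine ⟨f.toLinearMap, ?_, ?_⟩
  · intro e
    exact hf (Representation.IntertwiningMap.ext_iff.2 e)
  · intro g v w
    have := LinearMap.congr_fun (Representation.IntertwiningMap.isIntertwining ρ ρ.dual f g v) (ρ g w)
    refine this.trans ?_
    rw [Representation.dual_apply, Dual.transpose_apply, LinearMap.comp_apply,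
      Representation.inv_self_apply]
    rfl

theorem isConj_inv_of_isRationalGroup (hG : IsRationalGroup G) (g : G) : IsConj g g⁻¹ :=
  hG g g⁻¹ Subgroup.zpowers_inv

end SelfDual

/-! ### A subspace whose stabilizer has index two -/

section Imprimitive

variable {k G V : Type*} [Field k] [Group G] [AddCommGroup V] [Module k V]
  {ρ : Representation k G V}

theorem mem_normalizer_of_forall_mem [FiniteDimensional k V] {U : Submodule k V} {g : G}
    (h : ∀ u ∈ U, ρ g u ∈ U) : g ∈ normalizer ρ U := by
  change U.map (ρ g) = U
  refine Submodule.eq_of_le_of_finrank_eq ?_ (finrank_map_apply ρ g U)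
  rintro _ ⟨u, hu, rfl⟩
  exact h u hu

theorem sq_eq_one_of_invariant_form {B : V →ₗ[k] V →ₗ[k] k} (hB : B ≠ 0)
    (hinv : ∀ g v w, B (ρ g v) (ρ g w) = B v w) {g : G} {c : k} (hc : ∀ v, ρ g v = c • v) :
    c ^ 2 = 1 := by
  obtain ⟨v, w, hvw⟩ : ∃ v w, B v w ≠ 0 := by
    by_contra! h
    exact hB (LinearMap.ext fun v => LinearMap.ext fun w => h v w)
  have := hinv g v w
  rw [hc, hc, LinearMap.map_smul₂, map_smul, smul_smul, ← pow_two, smul_eq_mul] at this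
  exact mul_right_cancel₀ hvw (this.trans (one_mul _).symm)

/-- The elements acting as `1` or `-1`. -/
def signSubgroup (ρ : Representation k G V) : Subgroup G where
  carrier := {g | ρ g = 1 ∨ ρ g = -1}
  mul_mem' := by
    rintro a b (ha | ha) (hb | hb) <;> simp [ha, hb]
  one_mem' := by simp
  inv_mem' := by
    intro a ha
    have h : ρ a⁻¹ * ρ a = 1 := by rw [← map_mul, inv_mul_cancel, map_one]
    rcases ha with ha | ha
    · left
      simpa [ha] using h
    · right
      rw [ha, mul_neg, mul_one] at h
      rw [← h, neg_neg]

instance signSubgroup_normal (ρ : Representation k G V) : (signSubgroup ρ).Normal where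
  conj_mem := by
    intro n hn g
    have h : ρ g * ρ g⁻¹ = 1 := by rw [← map_mul, mul_inv_cancel, map_one]
    rcases hn with hn | hn
    · left
      rw [map_mul, map_mul, hn, mul_one, h]
    · right
      rw [map_mul, map_mul, hn, mul_neg, mul_one, neg_mul, h]

/-- Such a `b` represents an involution in the centre of `G` modulo `signSubgroup ρ`. -/
theorem exists_sq_and_commute_up_to_sign [Finite G] (hG : IsPGroup 2 G)
    (hne : signSubgroup ρ ≠ ⊤) :
    ∃ b, b ∉ signSubgroup ρ ∧ (ρ b * ρ b = 1 ∨ ρ b * ρ b = -1) ∧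
      ∀ g, ρ b * ρ g = ρ g * ρ b ∨ ρ b * ρ g = -(ρ g * ρ b) := by
  have hnt : Nontrivial (G ⧸ signSubgroup ρ) := by
    by_contra hc
    rw [not_nontrivial_iff_subsingleton] at hc
    exact hne (QuotientGroup.subgroup_eq_top_of_subsingleton _ hc)
  have hQ : IsPGroup 2 (G ⧸ signSubgroup ρ) := hG.to_quotient _
  have hcn := hQ.center_nontrivial
  obtain ⟨n, hn, hcard⟩ := (hQ.to_subgroup (Subgroup.center _)).nontrivial_iff_card.1 hcn
  obtain ⟨⟨x, hx⟩, hx2⟩ := exists_prime_orderOf_dvd_card' (G := Subgroup.center (G ⧸ signSubgroup ρ))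
    2 (hcard ▸ dvd_pow_self 2 hn.ne')
  obtain ⟨b, rfl⟩ := QuotientGroup.mk_surjective x
  refine ⟨b, ?_, ?_, ?_⟩
  · intro hb
    have h1 : (⟨(b : G ⧸ signSubgroup ρ), hx⟩ : Subgroup.center (G ⧸ signSubgroup ρ)) = 1 :=
      Subtype.ext ((QuotientGroup.eq_one_iff b).2 hb)
    rw [h1, orderOf_one] at hx2
    omega
  · have h2 := congrArg Subtype.val (pow_orderOf_eq_one
      (⟨(b : G ⧸ signSubgroup ρ), hx⟩ : Subgroup.center (G ⧸ signSubgroup ρ)))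
    rw [hx2] at h2
    have h3 : ((b * b : G) : G ⧸ signSubgroup ρ) = 1 := by
      rw [QuotientGroup.mk_mul, ← pow_two]
      exact h2
    have := (QuotientGroup.eq_one_iff _).1 h3
    rwa [← map_mul]
  · intro g
    have h2 := (Subgroup.mem_center_iff.1 hx) (g : G ⧸ signSubgroup ρ)
    rw [← QuotientGroup.mk_mul, ← QuotientGroup.mk_mul, QuotientGroup.eq] at h2
    have h3 : ρ b * ρ g = ρ g * ρ b * ρ ((g * b)⁻¹ * (b * g)) := by
      simp only [← map_mul]
      congr 1
      group
    rcases h2 with h2 | h2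
    · left
      rw [h3, h2, mul_one]
    · right
      rw [h3, h2, mul_neg, mul_one]

/-- A nonscalar element commuting with everything up to sign has two eigenspaces, which the group
permutes. -/
theorem exists_normalizer_index_eq_two [Finite G] (hG : IsPGroup 2 G) (h : ρ.IsIrreducible)
    {i : k} (hi : i ^ 2 = -1) (hscalar : ∀ (g : G) (c : k), (∀ v, ρ g v = c • v) → c ^ 2 = 1)
    (hne : signSubgroup ρ ≠ ⊤) :
    ∃ U : Submodule k V, U ≠ ⊥ ∧ (normalizer ρ U).index = 2 := by
  have hfd := finiteDimensional_of_isIrreducible h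
  obtain ⟨b, hb, hb2, hcomm⟩ := exists_sq_and_commute_up_to_sign hG hne
  obtain ⟨μ, hμ⟩ : ∃ μ : k, ∀ v, ρ b (ρ b v) = μ • μ • v := by
    rcases hb2 with hb2 | hb2
    · exact ⟨1, fun v => by simpa using LinearMap.congr_fun hb2 v⟩
    · refine ⟨i, fun v => ?_⟩
      rw [smul_smul, ← pow_two, hi]
      simpa using LinearMap.congr_fun hb2 v
  have hns : ∀ c : k, ¬ ∀ v, ρ b v = c • v := by
    intro c hc
    rcases sq_eq_one_iff.1 (hscalar b c hc) with rfl | rfl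
    · exact hb (Or.inl (LinearMap.ext fun v => by simpa using hc v))
    · exact hb (Or.inr (LinearMap.ext fun v => by simpa using hc v))
  let U : Submodule k V := End.eigenspace (ρ b) μ
  have hU : ∀ v, v ∈ U ↔ ρ b v = μ • v := fun v => End.mem_eigenspace_iff
  have hU0 : U ≠ ⊥ := by
    intro h0
    -- `ρ b v + μ • v` is always a `μ`-eigenvector, since `ρ b * ρ b = μ ^ 2`.
    refine hns (-μ) fun v => ?_
    have : ρ b v + μ • v ∈ U := by
      rw [hU, map_add, map_smul, hμ, smul_add, add_comm]
    rw [h0, Submodule.mem_bot] at this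
    rw [neg_smul]
    exact eq_neg_of_add_eq_zero_left this
  have hUt : U ≠ ⊤ := fun ht => hns μ fun v => (hU v).1 (ht ▸ Submodule.mem_top)
  have hplus : ∀ g, ρ b * ρ g = ρ g * ρ b → g ∈ normalizer ρ U := by
    intro g hg
    refine mem_normalizer_of_forall_mem fun u hu => ?_
    have := LinearMap.congr_fun hg u
    rw [Module.End.mul_apply, Module.End.mul_apply, (hU u).1 hu, map_smul] at this
    exact (hU _).2 this
  refine ⟨U, hU0, Subgroup.index_eq_two_iff_exists_notMem_and.2 ?_⟩
  obtain ⟨a, ha⟩ : ∃ a, a ∉ normalizer ρ U := by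
    by_contra! hc
    rcases eq_bot_or_eq_top_of_isIrreducible h U
      (fun g u hu => apply_mem_of_mem_normalizer ρ U ⟨g, hc g⟩ u hu) with h1 | h1
    · exact hU0 h1
    · exact hUt h1
  refine ⟨a, ha, fun g => ?_⟩
  rcases hcomm g with hg | hg
  · exact Or.inr (hplus g hg)
  · have ha' := (hcomm a).resolve_left fun e => ha (hplus a e)
    refine Or.inl (hplus _ ?_)
    rw [map_mul, ← mul_assoc, hg, neg_mul, mul_assoc, ha', mul_neg, neg_neg, mul_assoc]

end Imprimitive

/-! ### The stabilizer acting on the subspace -/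

section IndexTwo

variable {k G V : Type*} [Field k] [Group G] [AddCommGroup V] [Module k V]
  {ρ : Representation k G V} {U : Submodule k V} {t : G}

theorem apply_mem_of_mem {g : G} (hg : g ∈ normalizer ρ U) :
    ∀ u ∈ U, ρ g u ∈ U :=
  apply_mem_of_mem_normalizer ρ U ⟨g, hg⟩

theorem isCompl_translate (h : ρ.IsIrreducible) (hU : U ≠ ⊥)
    (hM : (normalizer ρ U).index = 2) (ht : t ∉ normalizer ρ U) : IsCompl U (U.map (ρ t)) := by
  have hinv : ∀ g ∈ normalizer ρ U, ∀ u ∈ U, ρ g u ∈ U := fun g => apply_mem_of_mem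
  rw [isCompl_iff, disjoint_iff, codisjoint_iff]
  refine ⟨?_, sup_translate_eq_top h hM ht hinv hU⟩
  refine (inf_translate_eq_bot_or_eq_top h hM ht hinv).resolve_right fun e => ht ?_
  have hU : U = ⊤ := eq_top_iff.2 (e ▸ inf_le_left)
  have hU' : U.map (ρ t) = ⊤ := eq_top_iff.2 (e ▸ inf_le_right)
  exact hU'.trans hU.symm

theorem finrank_eq_two_mul [FiniteDimensional k V] (h : ρ.IsIrreducible) (hU : U ≠ ⊥)
    (hM : (normalizer ρ U).index = 2) : finrank k V = 2 * finrank k U := by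
  obtain ⟨t, ht, -⟩ := Subgroup.index_eq_two_iff_exists_notMem_and.1 hM
  have := Submodule.finrank_add_eq_of_isCompl (isCompl_translate h hU hM ht)
  rw [finrank_map_apply] at this
  omega

theorem mem_normalizer_of_apply_mem (h : ρ.IsIrreducible) (hU : U ≠ ⊥)
    (hM : (normalizer ρ U).index = 2) {g : G} {u : V} (hu : u ∈ U) (h0 : u ≠ 0)
    (hgu : ρ g u ∈ U) : g ∈ normalizer ρ U := by
  by_contra hg
  have hd := (isCompl_translate h hU hM hg).disjoint
  have := Submodule.disjoint_def.1 hd _ hgu ⟨u, hu, rfl⟩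
  exact h0 ((ρ.apply_bijective g).1 (this.trans (map_zero _).symm))

/-- An invariant subspace `W` of `U` and its translate span `V`, so `W` has at least half the
dimension of `V`. -/
theorem isIrreducible_normalizerRep [FiniteDimensional k V] (h : ρ.IsIrreducible) (hU : U ≠ ⊥)
    (hM : (normalizer ρ U).index = 2) : (normalizerRep ρ U).IsIrreducible := by
  have : Nontrivial U := (Submodule.nontrivial_iff_ne_bot).2 hU
  obtain ⟨t, ht, -⟩ := Subgroup.index_eq_two_iff_exists_notMem_and.1 hM
  refine isIrreducible_of_forall_submodule fun W hW => ?_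
  by_cases hW0 : W = ⊥
  · exact Or.inl hW0
  right
  have hWV : W.map U.subtype ≠ ⊥ := fun e =>
    hW0 (Submodule.map_injective_of_injective U.injective_subtype
      (e.trans (Submodule.map_bot _).symm))
  have hinv : ∀ g ∈ normalizer ρ U, ∀ u ∈ W.map U.subtype, ρ g u ∈ W.map U.subtype := by
    rintro g hg _ ⟨w, hw, rfl⟩
    exact ⟨normalizerRep ρ U ⟨g, hg⟩ w, hW _ w hw, rfl⟩
  have hsup := sup_translate_eq_top h hM ht hinv hWV
  have hle := Submodule.finrank_add_le_finrank_add_finrank (W.map U.subtype)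
    ((W.map U.subtype).map (ρ t))
  rw [hsup, finrank_top, finrank_map_apply, Submodule.finrank_map_subtype_eq,
    finrank_eq_two_mul h hU hM] at hle
  exact Submodule.eq_top_of_finrank_eq (le_antisymm (Submodule.finrank_le W) (by omega))

theorem hasEigenvectorProperty_normalizerRep (heig : HasEigenvectorProperty ρ)
    (hblock : ∀ g, ∀ u ∈ U, u ≠ 0 → ρ g u ∈ U → g ∈ normalizer ρ U) :
    HasEigenvectorProperty (normalizerRep ρ U) := by
  rintro ⟨v, hv⟩ c hc
  by_cases h0 : v = 0
  · subst h0
    refine ⟨1, Subtype.ext ?_⟩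
    simp [normalizerRep]
  · obtain ⟨g, hg⟩ := heig v c hc
    exact ⟨⟨g, hblock g v hv h0 (hg ▸ U.smul_mem c hv)⟩, Subtype.ext hg⟩

/-- If `U` meets its other translates only in `0`, the stabilizer in `G` of a nonzero subspace of
`U` already lies in the stabilizer of `U`. -/
theorem normalizer_map_subtype (hblock : ∀ g, ∀ u ∈ U, u ≠ 0 → ρ g u ∈ U → g ∈ normalizer ρ U)
    {W : Submodule k U} (hW : W ≠ ⊥) :
    normalizer ρ (W.map U.subtype) =
      (normalizer (normalizerRep ρ U) W).map (normalizer ρ U).subtype := by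
  have key : ∀ g : normalizer ρ U, (W.map U.subtype).map (ρ g) =
      (W.map (normalizerRep ρ U g)).map U.subtype := by
    intro g
    rw [← Submodule.map_comp, ← Submodule.map_comp]
    rfl
  ext g
  constructor
  · intro hg
    change (W.map U.subtype).map (ρ g) = W.map U.subtype at hg
    obtain ⟨w, hw, hw0⟩ := W.exists_mem_ne_zero_of_ne_bot hW
    have hgw : ρ g w ∈ W.map U.subtype := hg ▸ Submodule.mem_map_of_mem ⟨w, hw, rfl⟩
    have hgU : g ∈ normalizer ρ U := hblock g w w.2 (fun e => hw0 (Subtype.ext e))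
      (Submodule.map_subtype_le _ _ hgw)
    refine ⟨⟨g, hgU⟩, ?_, rfl⟩
    exact Submodule.map_injective_of_injective U.injective_subtype ((key ⟨g, hgU⟩).symm.trans hg)
  · rintro ⟨g, hg, rfl⟩
    change W.map (normalizerRep ρ U g) = W at hg
    change (W.map U.subtype).map (ρ g) = W.map U.subtype
    rw [key, hg]

end IndexTwo

/-! ### Quaternion planes -/

/-- The span of `w₁` and `w₂` is a plane on which its normalizer acts through the group of
matrices `!![a, 0; 0, a⁻¹]` and `!![0, -a⁻¹; a, 0]`, with `a` a nonzero scalar. Over the field with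
five elements this is the quaternion group of order eight. -/
structure IsQuaternionPair {k G V : Type*} [Field k] [Group G] [AddCommGroup V] [Module k V]
    (ρ : Representation k G V) (w₁ w₂ : V) : Prop where
  linearIndependent : ∀ s t : k, s • w₁ + t • w₂ = 0 → s = 0 ∧ t = 0
  exists_diagonal : ∀ a : k, a ≠ 0 → ∃ g, ρ g w₁ = a • w₁ ∧ ρ g w₂ = a⁻¹ • w₂
  exists_antidiagonal : ∀ a : k, a ≠ 0 → ∃ g, ρ g w₁ = a • w₂ ∧ ρ g w₂ = -a⁻¹ • w₁
  diagonal_or_antidiagonal : ∀ g ∈ normalizer ρ (Submodule.span k {w₁, w₂}), ∃ a : k, a ≠ 0 ∧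
    ((ρ g w₁ = a • w₁ ∧ ρ g w₂ = a⁻¹ • w₂) ∨ (ρ g w₁ = a • w₂ ∧ ρ g w₂ = -a⁻¹ • w₁))

section Block

variable {k G V : Type*} [Field k] [Group G] [AddCommGroup V] [Module k V]
  {ρ : Representation k G V} {U : Submodule k V}

theorem IsQuaternionPair.of_normalizerRep
    (hblock : ∀ g, ∀ u ∈ U, u ≠ 0 → ρ g u ∈ U → g ∈ normalizer ρ U) {w₁ w₂ : U}
    (h : IsQuaternionPair (normalizerRep ρ U) w₁ w₂) :
    IsQuaternionPair ρ (w₁ : V) (w₂ : V) ∧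
      (normalizer ρ (Submodule.span k {(w₁ : V), (w₂ : V)})).index =
        (normalizer (normalizerRep ρ U) (Submodule.span k {w₁, w₂})).index *
          (normalizer ρ U).index := by
  have h0 : w₁ ≠ 0 := by
    rintro rfl
    exact one_ne_zero (h.linearIndependent 1 0 (by simp)).1
  have hspan : Submodule.span k {(w₁ : V), (w₂ : V)} =
      (Submodule.span k {w₁, w₂}).map U.subtype := by
    rw [Submodule.map_span, Set.image_pair]
    rfl
  have hne : Submodule.span k {w₁, w₂} ≠ ⊥ := by
    intro e
    rw [Submodule.span_eq_bot] at e
    exact h0 (e w₁ (by simp))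
  have hN := normalizer_map_subtype hblock hne
  rw [← hspan] at hN
  refine ⟨⟨?_, ?_, ?_, ?_⟩, ?_⟩
  · intro s t hst
    exact h.linearIndependent s t (Subtype.ext hst)
  · intro a ha
    obtain ⟨g, h1, h2⟩ := h.exists_diagonal a ha
    exact ⟨g, congrArg Subtype.val h1, congrArg Subtype.val h2⟩
  · intro a ha
    obtain ⟨g, h1, h2⟩ := h.exists_antidiagonal a ha
    exact ⟨g, congrArg Subtype.val h1, congrArg Subtype.val h2⟩
  · intro g hg
    rw [hN] at hg
    obtain ⟨g, hg, rfl⟩ := hg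
    obtain ⟨a, ha, h1⟩ := h.diagonal_or_antidiagonal g hg
    exact ⟨a, ha, h1.imp (fun h => ⟨congrArg Subtype.val h.1, congrArg Subtype.val h.2⟩)
      (fun h => ⟨congrArg Subtype.val h.1, congrArg Subtype.val h.2⟩)⟩
  · rw [hN, Subgroup.index_map_subtype]

end Block

/-! ### Totally isotropic summands -/

section Isotropic

variable {k G V : Type*} [Field k] [Group G] [AddCommGroup V] [Module k V]
  {ρ : Representation k G V} {B : V →ₗ[k] V →ₗ[k] k} {U : Submodule k V} {t : G}

theorem eq_zero_of_forall_form_eq_zero (h : ρ.IsIrreducible) (hB : B ≠ 0)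
    (hinv : ∀ g v w, B (ρ g v) (ρ g w) = B v w) {v : V} (hv : ∀ w, B v w = 0) : v = 0 := by
  have hk : LinearMap.ker B = ⊥ := by
    refine (eq_bot_or_eq_top_of_isIrreducible h _ ?_).resolve_right
      (fun e => hB (LinearMap.ker_eq_top.1 e))
    intro g w hw
    rw [LinearMap.mem_ker] at hw ⊢
    ext x
    have := hinv g w (ρ g⁻¹ x)
    rw [Representation.self_inv_apply, hw] at this
    exact this
  have : v ∈ LinearMap.ker B := LinearMap.mem_ker.2 (LinearMap.ext hv)
  rwa [hk, Submodule.mem_bot] at this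

theorem exists_form_ne_zero (h : ρ.IsIrreducible) (hB : B ≠ 0)
    (hinv : ∀ g v w, B (ρ g v) (ρ g w) = B v w) (hc : IsCompl U (U.map (ρ t)))
    (hiso : ∀ u ∈ U, ∀ v ∈ U, B u v = 0) {a : V} (ha : a ∈ U) (ha0 : a ≠ 0) :
    ∃ b ∈ U.map (ρ t), B a b ≠ 0 := by
  by_contra! hcon
  refine ha0 (eq_zero_of_forall_form_eq_zero h hB hinv fun w => ?_)
  obtain ⟨u, hu, u', hu', rfl⟩ := Submodule.mem_sup.1 (hc.sup_eq_top ▸ Submodule.mem_top : w ∈ _)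
  rw [map_add, hiso a ha u hu, hcon u' hu', add_zero]

theorem exists_form_ne_zero_and (h : ρ.IsIrreducible) (hB : B ≠ 0)
    (hinv : ∀ g v w, B (ρ g v) (ρ g w) = B v w) (hc : IsCompl U (U.map (ρ t)))
    (hiso : ∀ u ∈ U, ∀ v ∈ U, B u v = 0) {a a' : V} (ha : a ∈ U) (ha0 : a ≠ 0)
    (ha' : a' ∈ U) (ha0' : a' ≠ 0) : ∃ b ∈ U.map (ρ t), B a b ≠ 0 ∧ B a' b ≠ 0 := by
  obtain ⟨b, hb, h1⟩ := exists_form_ne_zero h hB hinv hc hiso ha ha0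
  obtain ⟨b', hb', h2⟩ := exists_form_ne_zero h hB hinv hc hiso ha' ha0'
  by_cases h3 : B a' b = 0
  · by_cases h4 : B a b' = 0
    · exact ⟨b + b', add_mem hb hb', by simpa [h4] using h1, by simpa [h3] using h2⟩
    · exact ⟨b', hb', h4, h2⟩
  · exact ⟨b, hb, h1, h3⟩

/-- An element multiplying `a + b` by `c` cannot respect the decomposition, since it would
multiply `B a b` by `c ^ 2`; so it interchanges the two summands. -/
theorem exists_swap (heig : HasEigenvectorProperty ρ)
    (hinv : ∀ g v w, B (ρ g v) (ρ g w) = B v w) (hM : (normalizer ρ U).index = 2)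
    (ht : t ∉ normalizer ρ U) (hc : IsCompl U (U.map (ρ t))) {a b : V} (ha : a ∈ U)
    (hb : b ∈ U.map (ρ t)) (hab : B a b ≠ 0) {c : k} (hc0 : c ≠ 0) (hc2 : c ^ 2 ≠ 1) :
    ∃ g, g ∉ normalizer ρ U ∧ ρ g a = c • b ∧ ρ g b = c • a := by
  obtain ⟨g, hg⟩ := heig (a + b) c hc0
  rw [map_add, smul_add] at hg
  have key := apply_mem_translate_of_index_two (ρ := ρ) hM ht
    (fun g hg => apply_mem_of_mem hg) g
  have hdisj := Submodule.disjoint_def.1 hc.disjoint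
  by_cases hgM : g ∈ normalizer ρ U
  · exfalso
    have e : ρ g a - c • a = c • b - ρ g b := by
      rw [sub_eq_sub_iff_add_eq_add, hg, add_comm]
    have h1 : ρ g a - c • a = 0 := hdisj _
      (sub_mem (apply_mem_of_mem hgM a ha) (U.smul_mem c ha))
      (e ▸ sub_mem (Submodule.smul_mem _ c hb) (key.1 hgM b hb))
    have h2 := (e ▸ h1 : c • b - ρ g b = 0)
    have h3 := hinv g a b
    rw [sub_eq_zero.1 h1, ← sub_eq_zero.1 h2, LinearMap.map_smul₂, map_smul, smul_smul, ← pow_two,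
      smul_eq_mul] at h3
    exact hc2 (mul_right_cancel₀ hab (h3.trans (one_mul _).symm))
  · have e : ρ g a - c • b = c • a - ρ g b := by
      rw [sub_eq_sub_iff_add_eq_add, hg]
    have h1 : ρ g a - c • b = 0 := hdisj _
      (e ▸ sub_mem (U.smul_mem c ha) ((key.2 hgM).2 b hb))
      (sub_mem ((key.2 hgM).1 a ha) (Submodule.smul_mem _ c hb))
    have h2 := (e ▸ h1 : c • a - ρ g b = 0)
    exact ⟨g, hgM, sub_eq_zero.1 h1, (sub_eq_zero.1 h2).symm⟩

/-- Transitivity on the nonzero vectors of `U`: two of them are joined through a vector of the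
other summand that is orthogonal to neither. -/
theorem exists_apply_eq (h : ρ.IsIrreducible) (heig : HasEigenvectorProperty ρ) (hB : B ≠ 0)
    (hinv : ∀ g v w, B (ρ g v) (ρ g w) = B v w) (hM : (normalizer ρ U).index = 2)
    (ht : t ∉ normalizer ρ U) (hc : IsCompl U (U.map (ρ t)))
    (hiso : ∀ u ∈ U, ∀ v ∈ U, B u v = 0) {c : k} (hc0 : c ≠ 0) (hc2 : c ^ 2 ≠ 1)
    {a a' : V} (ha : a ∈ U) (ha0 : a ≠ 0) (ha' : a' ∈ U) (ha0' : a' ≠ 0) :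
    ∃ g, ρ g a = a' := by
  obtain ⟨b, hb, h1, h2⟩ := exists_form_ne_zero_and h hB hinv hc hiso ha ha0 ha' ha0'
  obtain ⟨g, -, hg, -⟩ := exists_swap heig hinv hM ht hc ha hb h1 hc0 hc2
  obtain ⟨g', -, hg', -⟩ := exists_swap heig hinv hM ht hc ha' hb h2 hc0 hc2
  refine ⟨g'⁻¹ * g, ?_⟩
  rw [map_mul, Module.End.mul_apply, hg, ← hg', Representation.inv_self_apply]

end Isotropic

theorem exists_card_eq_two_pow_add_one {k G V : Type*} [Field k] [Group G] [AddCommGroup V]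
    [Module k V] [Finite G] [Finite V] (ρ : Representation k G V) (hG : IsPGroup 2 G)
    {a : V} (ha : a ≠ 0) (htrans : ∀ v, v ≠ 0 → ∃ g, ρ g a = v) :
    ∃ n, Nat.card V = 2 ^ n + 1 := by
  let : MulAction G V :=
    { smul := fun g v => ρ g v
      one_smul := fun v => by change ρ 1 v = v; simp
      mul_smul := fun g g' v => by change ρ (g * g') v = ρ g (ρ g' v); simp }
  obtain ⟨n, hn⟩ := hG.card_orbit a
  have horb : MulAction.orbit G a = {0}ᶜ := by
    ext v
    constructor
    · rintro ⟨g, rfl⟩ h0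
      exact ha ((ρ.apply_bijective g).1 ((show ρ g a = 0 from h0).trans (map_zero _).symm))
    · intro hv
      exact htrans v hv
  refine ⟨n, ?_⟩
  rw [horb, Nat.card_coe_set_eq] at hn
  have := Set.ncard_add_ncard_compl ({0} : Set V)
  rw [hn, Set.ncard_singleton] at this
  omega

/-- If `m` were positive, `p ^ 2 ^ m - 1` would be the product of two powers of two that differ by
`2`, and so `p ^ 2 ^ (m - 1) = 3`. -/
theorem eq_zero_of_pow_two_pow_eq {p m n : ℕ} (hp : 5 ≤ p) (h : p ^ 2 ^ m = 2 ^ n + 1) : m = 0 := by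
  by_contra hm
  obtain ⟨l, rfl⟩ := Nat.exists_eq_succ_of_ne_zero hm
  set q := p ^ 2 ^ l with hq
  have hq5 : 5 ≤ q := hp.trans (Nat.le_self_pow (by positivity) p)
  have hsq : p ^ 2 ^ (l + 1) = q * q := by rw [hq, pow_succ, pow_mul, pow_two]
  obtain ⟨r, hr⟩ : ∃ r, q = r + 1 := ⟨q - 1, by omega⟩
  have hprod : r * (r + 2) = 2 ^ n := by
    have : q * q = 2 ^ n + 1 := hsq ▸ h
    rw [hr] at this
    linarith
  obtain ⟨x, -, hx⟩ := (Nat.dvd_prime_pow Nat.prime_two).1 (Dvd.intro _ hprod)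
  obtain ⟨y, -, hy⟩ := (Nat.dvd_prime_pow Nat.prime_two).1 (Dvd.intro_left _ hprod)
  have hx2 : 2 ≤ x := by
    by_contra hlt
    have : 2 ^ x ≤ 2 ^ 1 := Nat.pow_le_pow_right (by norm_num) (by omega)
    omega
  have hy2 : 2 ≤ y := by
    by_contra hlt
    have : 2 ^ y ≤ 2 ^ 1 := Nat.pow_le_pow_right (by norm_num) (by omega)
    omega
  have h4x : 4 ∣ 2 ^ x := pow_dvd_pow 2 hx2
  have h4y : 4 ∣ 2 ^ y := pow_dvd_pow 2 hy2
  omega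

/-! ### The action on a plane -/

section QuaternionPlane

variable {k G V : Type*} [Field k] [Group G] [AddCommGroup V] [Module k V]
  {ρ : Representation k G V} {B : V →ₗ[k] V →ₗ[k] k} {U : Submodule k V} {t : G}

theorem exists_isQuaternionPair_of_finrank_eq_one (h : ρ.IsIrreducible)
    (heig : HasEigenvectorProperty ρ) (hB : B ≠ 0)
    (hinv : ∀ g v w, B (ρ g v) (ρ g w) = B v w) (hM : (normalizer ρ U).index = 2)
    (ht : t ∉ normalizer ρ U) (hc : IsCompl U (U.map (ρ t)))
    (hiso : ∀ u ∈ U, ∀ v ∈ U, B u v = 0) {i : k} (hi : i ^ 2 = -1) (h2 : (2 : k) ≠ 0)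
    (h3 : (3 : k) ≠ 0) (hU : finrank k U = 1) :
    (5 : k) = 0 ∧ ∃ w₁ w₂ : V, IsQuaternionPair ρ w₁ w₂ ∧ Submodule.span k {w₁, w₂} = ⊤ := by
  obtain ⟨⟨w, hwU⟩, hw0, hspan⟩ := finrank_eq_one_iff'.1 hU
  replace hw0 : w ≠ 0 := fun e => hw0 (Subtype.ext e)
  replace hspan : ∀ u ∈ U, ∃ c : k, c • w = u := by
    intro u hu
    obtain ⟨c, hc⟩ := hspan ⟨u, hu⟩
    exact ⟨c, congrArg Subtype.val hc⟩
  obtain ⟨b, hb, hwb⟩ := exists_form_ne_zero h hB hinv hc hiso hwU hw0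
  have hi0 : i ≠ 0 := by
    rintro rfl
    simp at hi
  have hi2 : i ^ 2 ≠ 1 := by
    rw [hi]
    intro e
    exact h2 (by linear_combination -e)
  have hb0 : b ≠ 0 := by
    rintro rfl
    simp at hwb
  have hspan' : ∀ u ∈ U.map (ρ t), ∃ c : k, c • b = u := by
    have h1 := finrank_map_apply ρ t U
    rw [hU] at h1
    obtain ⟨⟨x, hx⟩, hx0, hs⟩ := finrank_eq_one_iff'.1 h1
    obtain ⟨d, hd⟩ := hs ⟨b, hb⟩
    have hd : d • x = b := congrArg Subtype.val hd
    have hd0 : d ≠ 0 := by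
      rintro rfl
      exact hb0 (by rw [← hd, zero_smul])
    intro u hu
    obtain ⟨e, he⟩ := hs ⟨u, hu⟩
    have he : e • x = u := congrArg Subtype.val he
    exact ⟨e * d⁻¹, by rw [← hd, smul_smul, mul_assoc, inv_mul_cancel₀ hd0, mul_one, he]⟩
  obtain ⟨s, hs, hsw, hsb⟩ := exists_swap heig hinv hM ht hc hwU hb hwb hi0 hi2
  -- The swap `s` for `i` gives `B b w = -B w b`; the one for `2` gives `4 * B b w = B w b`.
  have hBs := hinv s w b
  rw [hsw, hsb, LinearMap.map_smul₂, map_smul, smul_smul, ← pow_two, hi, smul_eq_mul] at hBs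
  have h5 : (5 : k) = 0 := by
    have h22 : (2 : k) ^ 2 ≠ 1 := fun e => h3 (by linear_combination e)
    obtain ⟨g, -, hg, hg'⟩ := exists_swap heig hinv hM ht hc hwU hb hwb h2 h22
    have := hinv g w b
    rw [hg, hg', LinearMap.map_smul₂, map_smul, smul_smul, smul_eq_mul] at this
    have hbw : B b w ≠ 0 := by
      intro e
      rw [e, mul_zero] at hBs
      exact hwb hBs.symm
    refine (mul_eq_zero.1 ?_).resolve_right hbw
    linear_combination this - hBs
  -- Rescaling `b` by `i` turns `s` into `w ↦ i • b`, `i • b ↦ -w`.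
  refine ⟨h5, w, i • b, ?_⟩
  have hw2 : i • b ∈ U.map (ρ t) := Submodule.smul_mem _ i hb
  have hw20 : i • b ≠ 0 := smul_ne_zero hi0 hb0
  have hB2 : B w (i • b) ≠ 0 := by
    rw [map_smul]
    exact smul_ne_zero hi0 hwb
  have hs2 : ρ s (i • b) = -w := by
    rw [map_smul, hsb, smul_smul, ← pow_two, hi, neg_one_smul]
  have hspan2 : ∀ u ∈ U.map (ρ t), ∃ c : k, c • (i • b) = u := by
    intro u hu
    obtain ⟨e, he⟩ := hspan' u hu
    exact ⟨e * i⁻¹, by rw [smul_smul, mul_assoc, inv_mul_cancel₀ hi0, mul_one, he]⟩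
  have hdisj := Submodule.disjoint_def.1 hc.disjoint
  generalize i • b = w' at *
  have hB21 : B w' w = -B w w' := by
    have := hinv s w w'
    rw [hsw, hs2, map_neg] at this
    rw [← this, neg_neg]
  have key := apply_mem_translate_of_index_two (ρ := ρ) hM ht
    (fun g hg => apply_mem_of_mem hg)
  have hdiag : ∀ g ∈ normalizer ρ U, ∃ a : k, a ≠ 0 ∧ ρ g w = a • w ∧ ρ g w' = a⁻¹ • w' := by
    intro g hg
    obtain ⟨x, hx⟩ := hspan _ (apply_mem_of_mem hg w hwU)
    obtain ⟨y, hy⟩ := hspan2 _ ((key g).1 hg w' hw2)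
    have := hinv g w w'
    rw [← hx, ← hy, LinearMap.map_smul₂, map_smul, smul_smul, smul_eq_mul] at this
    have hxy : x * y = 1 := mul_right_cancel₀ hB2 (this.trans (one_mul _).symm)
    have hx0 : x ≠ 0 := left_ne_zero_of_mul_eq_one hxy
    refine ⟨x, hx0, hx.symm, ?_⟩
    rw [← hy, eq_inv_of_mul_eq_one_right hxy]
  have hdiag' : ∀ a : k, a ≠ 0 → ∃ g, ρ g w = a • w ∧ ρ g w' = a⁻¹ • w' := by
    intro a ha
    obtain ⟨g, hg⟩ := heig w a ha
    have hgM : g ∈ normalizer ρ U := by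
      by_contra hgM
      have h1 := ((key g).2 hgM).1 w hwU
      have h2 := hdisj _ (hg ▸ U.smul_mem a hwU) h1
      rw [hg] at h2
      exact smul_ne_zero ha hw0 h2
    obtain ⟨x, -, hx, hx'⟩ := hdiag g hgM
    have : x = a := smul_left_injective k hw0 (hx.symm.trans hg)
    exact ⟨g, hg, this ▸ hx'⟩
  refine ⟨⟨?_, hdiag', ?_, ?_⟩, ?_⟩
  · intro x y hxy
    have h1 : x • w = -(y • w') := eq_neg_of_add_eq_zero_left hxy
    have h2 := hdisj (x • w) (U.smul_mem x hwU) (h1 ▸ neg_mem (Submodule.smul_mem _ y hw2))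
    have h4 : y • w' = 0 := by rw [h2, zero_add] at hxy; exact hxy
    exact ⟨(smul_eq_zero.1 h2).resolve_right hw0, (smul_eq_zero.1 h4).resolve_right hw20⟩
  · intro a ha
    obtain ⟨g, h1, h2⟩ := hdiag' a ha
    refine ⟨s * g, ?_, ?_⟩
    · rw [map_mul, Module.End.mul_apply, h1, map_smul, hsw]
    · rw [map_mul, Module.End.mul_apply, h2, map_smul, hs2, smul_neg, neg_smul]
  · intro g _
    by_cases hg : g ∈ normalizer ρ U
    · obtain ⟨a, ha, h1⟩ := hdiag g hg
      exact ⟨a, ha, Or.inl h1⟩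
    · obtain ⟨x, hx⟩ := hspan2 _ (((key g).2 hg).1 w hwU)
      obtain ⟨y, hy⟩ := hspan _ (((key g).2 hg).2 w' hw2)
      have := hinv g w w'
      rw [← hx, ← hy, LinearMap.map_smul₂, map_smul, smul_smul, smul_eq_mul, hB21] at this
      have hxy : x * (-y) = 1 := mul_right_cancel₀ hB2 (by linear_combination this)
      have hx0 : x ≠ 0 := left_ne_zero_of_mul_eq_one hxy
      refine ⟨x, hx0, Or.inr ⟨hx.symm, ?_⟩⟩
      rw [← hy, ← eq_inv_of_mul_eq_one_right hxy, neg_neg]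
  · rw [eq_top_iff, ← hc.sup_eq_top, sup_le_iff]
    constructor
    · intro u hu
      obtain ⟨x, rfl⟩ := hspan u hu
      exact Submodule.smul_mem _ _ (Submodule.subset_span (by simp))
    · intro u hu
      obtain ⟨x, rfl⟩ := hspan2 u hu
      exact Submodule.smul_mem _ _ (Submodule.subset_span (by simp))

end QuaternionPlane

/-! ### Induction over a prime field -/

section PrimeField

variable {p : ℕ} [Fact p.Prime]

theorem zmod_natCast_ne_zero {n : ℕ} (h0 : n ≠ 0) (hn : n < p) : (n : ZMod p) ≠ 0 := by
  rw [Ne, ZMod.natCast_eq_zero_iff]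
  exact fun h => absurd (Nat.le_of_dvd (Nat.pos_of_ne_zero h0) h) (by omega)

/-- If `p % 4 = 3`, a scalar of `2`-power order has square `1`; but `2 ^ 2 ≠ 1`. -/
theorem exists_sq_eq_neg_one (hp : 5 ≤ p) (h : ∀ c : ZMod p, c ≠ 0 → ∃ n, c ^ 2 ^ n = 1) :
    ∃ i : ZMod p, i ^ 2 = -1 := by
  have hs : IsSquare (-1 : ZMod p) := by
    rw [ZMod.exists_sq_eq_neg_one_iff]
    intro h3
    have h2 : (2 : ZMod p) ≠ 0 := by exact_mod_cast zmod_natCast_ne_zero (n := 2) (by simp) (by omega)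
    obtain ⟨n, hn⟩ := h 2 h2
    obtain ⟨j, -, hj⟩ := (Nat.dvd_prime_pow Nat.prime_two).1 (orderOf_dvd_of_pow_eq_one hn)
    have hd := orderOf_dvd_of_pow_eq_one (ZMod.pow_card_sub_one_eq_one h2)
    have hj1 : j ≤ 1 := by
      by_contra hj1
      have h4 : 4 ∣ p - 1 := (pow_dvd_pow 2 (by omega : 2 ≤ j)).trans (hj ▸ hd)
      omega
    have h4 : (2 : ZMod p) ^ 2 = 1 := by
      rw [← orderOf_dvd_iff_pow_eq_one, hj]
      exact pow_dvd_pow 2 hj1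
    have h3 : (3 : ZMod p) ≠ 0 := by exact_mod_cast zmod_natCast_ne_zero (n := 3) (by simp) (by omega)
    exact h3 (by linear_combination h4)
  obtain ⟨i, hi⟩ := hs
  exact ⟨i, by rw [hi, pow_two]⟩

theorem exists_scalar_pow_two_pow_eq_one {k G V : Type*} [Field k] [Group G] [AddCommGroup V] [Module k V]
    {ρ : Representation k G V} [Nontrivial V] (hG : IsPGroup 2 G)
    (heig : HasEigenvectorProperty ρ) {c : k} (hc : c ≠ 0) : ∃ n, c ^ 2 ^ n = 1 := by
  obtain ⟨v, hv⟩ := exists_ne (0 : V)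
  obtain ⟨g, hg⟩ := heig v c hc
  obtain ⟨n, hn⟩ := hG g
  refine ⟨n, smul_left_injective k hv ?_⟩
  have key : ∀ m : ℕ, ρ (g ^ m) v = c ^ m • v := by
    intro m
    induction m with
    | zero => simp
    | succ m ih => rw [pow_succ', map_mul, Module.End.mul_apply, ih, map_smul, hg, smul_smul, pow_succ]
  have := key (2 ^ n)
  rw [hn] at this
  simpa using this.symm

/-- The factor `2` in the last equation is the dimension of the plane spanned by `w₁` and `w₂`. -/
theorem exists_isQuaternionPair (hp : 5 ≤ p) {n : ℕ} :
    ∀ {G V : Type*} [Group G] [Finite G] [AddCommGroup V] [Module (ZMod p) V]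
      {ρ : Representation (ZMod p) G V} {B : V →ₗ[ZMod p] V →ₗ[ZMod p] ZMod p},
      IsPGroup 2 G → ρ.IsIrreducible → HasEigenvectorProperty ρ → B ≠ 0 →
      (∀ g v w, B (ρ g v) (ρ g w) = B v w) → finrank (ZMod p) V = n →
      p = 5 ∧ ∃ w₁ w₂ : V, IsQuaternionPair ρ w₁ w₂ ∧
        finrank (ZMod p) V = (normalizer ρ (Submodule.span (ZMod p) {w₁, w₂})).index * 2 := by
  induction n using Nat.strong_induction_on with
  | _ n ih =>
  intro G V _ _ _ _ ρ B hG h heig hB hinv hn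
  have hfd := finiteDimensional_of_isIrreducible h
  have hV := nontrivial_of_isIrreducible h
  have h2 : (2 : ZMod p) ≠ 0 := by exact_mod_cast zmod_natCast_ne_zero (n := 2) (by simp) (by omega)
  have h3 : (3 : ZMod p) ≠ 0 := by exact_mod_cast zmod_natCast_ne_zero (n := 3) (by simp) (by omega)
  obtain ⟨i, hi⟩ := exists_sq_eq_neg_one hp fun c hc => exists_scalar_pow_two_pow_eq_one hG heig hc
  have hi0 : i ≠ 0 := by
    rintro rfl
    simp at hi
  have hi2 : i ^ 2 ≠ 1 := by
    rw [hi]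
    intro e
    exact h2 (by linear_combination -e)
  have hne : signSubgroup ρ ≠ ⊤ := by
    intro htop
    obtain ⟨v, hv⟩ := exists_ne (0 : V)
    obtain ⟨g, hg⟩ := heig v i hi0
    apply hi2
    rcases (htop ▸ Subgroup.mem_top g : g ∈ signSubgroup ρ) with h1 | h1
    · have : i = 1 := smul_left_injective _ hv (hg.symm.trans (by simp [h1]))
      rw [this, one_pow]
    · have : i = -1 := smul_left_injective _ hv (hg.symm.trans (by simp [h1]))
      rw [this, neg_one_sq]
  obtain ⟨U, hU, hM⟩ := exists_normalizer_index_eq_two hG h hi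
    (fun g c hc => sq_eq_one_of_invariant_form hB hinv hc) hne
  have hdim := finrank_eq_two_mul h hU hM
  have hblock : ∀ g, ∀ u ∈ U, u ≠ 0 → ρ g u ∈ U → g ∈ normalizer ρ U :=
    fun g u hu h0 hgu => mem_normalizer_of_apply_mem h hU hM hu h0 hgu
  by_cases hiso : ∀ u ∈ U, ∀ v ∈ U, B u v = 0
  · obtain ⟨t, ht, -⟩ := Subgroup.index_eq_two_iff_exists_notMem_and.1 hM
    have hc := isCompl_translate h hU hM ht
    have hU1 : finrank (ZMod p) U = 1 := by
      obtain ⟨m, hm⟩ := exists_finrank_eq_two_pow (hG.to_subgroup _)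
        (isIrreducible_normalizerRep h hU hM) rfl
      obtain ⟨a, ha, ha0⟩ := U.exists_mem_ne_zero_of_ne_bot hU
      have : Finite U := Module.finite_of_finite (ZMod p)
      obtain ⟨l, hl⟩ := exists_card_eq_two_pow_add_one (normalizerRep ρ U) (hG.to_subgroup _)
        (a := ⟨a, ha⟩) (fun e => ha0 (congrArg Subtype.val e)) (by
          rintro ⟨v, hv⟩ hv0
          obtain ⟨g, hg⟩ := exists_apply_eq h heig hB hinv hM ht hc hiso hi0 hi2 ha ha0 hv
            (fun e => hv0 (Subtype.ext e))
          exact ⟨⟨g, hblock g a ha ha0 (hg ▸ hv)⟩, Subtype.ext hg⟩)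
      rw [Module.natCard_eq_pow_finrank (K := ZMod p), Nat.card_zmod, hm] at hl
      rw [hm, eq_zero_of_pow_two_pow_eq hp hl, pow_zero]
    obtain ⟨h5, w₁, w₂, hw, hs⟩ := exists_isQuaternionPair_of_finrank_eq_one h heig hB hinv hM ht hc
      hiso hi h2 h3 hU1
    refine ⟨?_, w₁, w₂, hw, ?_⟩
    · have h5 : ((5 : ℕ) : ZMod p) = 0 := by exact_mod_cast h5
      rw [ZMod.natCast_eq_zero_iff] at h5
      exact (Nat.prime_dvd_prime_iff_eq Fact.out (by norm_num)).1 h5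
    · have : normalizer ρ (⊤ : Submodule (ZMod p) V) = ⊤ := by
        refine (Subgroup.eq_top_iff' _).2 fun g => ?_
        exact mem_normalizer_of_forall_mem fun _ _ => Submodule.mem_top
      rw [hs, this, Subgroup.index_top, hdim, hU1]
  · push Not at hiso
    obtain ⟨u, hu, v, hv, huv⟩ := hiso
    have hpos : 0 < finrank (ZMod p) V := finrank_pos
    obtain ⟨h5, w₁, w₂, hw, hw'⟩ := ih (finrank (ZMod p) U) (by omega)
      (B := B.domRestrict₁₂ U U) (hG.to_subgroup (normalizer ρ U))
      (isIrreducible_normalizerRep h hU hM) (hasEigenvectorProperty_normalizerRep heig hblock)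
      (fun e => huv (LinearMap.congr_fun (LinearMap.congr_fun e ⟨u, hu⟩) ⟨v, hv⟩))
      (fun g v w => hinv g v w) rfl
    obtain ⟨hq, hidx⟩ := hw.of_normalizerRep hblock
    refine ⟨h5, w₁, w₂, hq, ?_⟩
    rw [hidx, hM, hdim, hw']
    ring

end PrimeField

/-! ### Recognizing an induced module -/

section Induced

variable {k G V : Type*} [Field k] [Group G] [AddCommGroup V] [Module k V]

/-- The induced module is spanned by one copy of `U` for each coset of `N`. -/
theorem finrank_ind_le [Finite G] {N : Subgroup G} {U : Type*} [AddCommGroup U] [Module k U]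
    [FiniteDimensional k U] (σ : Representation k N U) :
    FiniteDimensional k (Representation.IndV N.subtype σ) ∧
      finrank k (Representation.IndV N.subtype σ) ≤ N.index * finrank k U := by
  classical
  have := Fintype.ofFinite (G ⧸ N)
  let ψ : ((G ⧸ N) → U) →ₗ[k] Representation.IndV N.subtype σ :=
    ∑ q : G ⧸ N, Representation.IndV.mk N.subtype σ q.out⁻¹ ∘ₗ LinearMap.proj q
  have hψ : Function.Surjective ψ := by
    rw [← LinearMap.range_eq_top, ← Submodule.ker_mkQ (LinearMap.range ψ), LinearMap.ker_eq_top]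
    refine Representation.IndV.hom_ext N.subtype σ fun g => LinearMap.ext fun u => ?_
    rw [LinearMap.comp_apply, LinearMap.zero_comp, LinearMap.zero_apply, Submodule.mkQ_apply,
      Submodule.Quotient.mk_eq_zero]
    obtain ⟨n, hn⟩ := QuotientGroup.mk_out_eq_mul N g⁻¹
    refine ⟨Pi.single (g⁻¹ : G) (σ n⁻¹ u), ?_⟩
    have h1 : ψ (Pi.single ((g⁻¹ : G) : G ⧸ N) (σ n⁻¹ u)) =
        Representation.IndV.mk N.subtype σ ((g⁻¹ : G) : G ⧸ N).out⁻¹ (σ n⁻¹ u) := by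
      rw [LinearMap.sum_apply, Finset.sum_eq_single ((g⁻¹ : G) : G ⧸ N)]
      · simp
      · intro q _ hq
        simp [hq]
      · simp
    rw [h1, hn, mul_inv_rev, inv_inv]
    have h2 := Representation.Coinvariants.mk_self_apply
      (Representation.tprod ((Representation.leftRegular k G).comp N.subtype) σ) n⁻¹
      (TensorProduct.tmul k (MonoidAlgebra.single g 1) u)
    refine Eq.trans ?_ h2
    simp [-Representation.Coinvariants.mk_self_apply]
  refine ⟨Module.Finite.of_surjective ψ hψ, ?_⟩
  have := LinearMap.finrank_le_finrank_of_surjective hψ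
  rwa [finrank_pi_fintype, Finset.sum_const, Finset.card_univ, ← Nat.card_eq_fintype_card,
    smul_eq_mul] at this

/-- The natural map from the induced module to an irreducible `V` is onto; the hypothesis on
dimensions makes it injective. -/
theorem nonempty_equiv_ind [Finite G] {ρ : Representation k G V} (h : ρ.IsIrreducible)
    {U : Submodule k V} (hU : U ≠ ⊥)
    (hdim : finrank k V = (normalizer ρ U).index * finrank k U) :
    Nonempty (ρ.Equiv (Representation.ind (normalizer ρ U).subtype (normalizerRep ρ U))) := by
  have hfd := finiteDimensional_of_isIrreducible h
  obtain ⟨hfin, hle⟩ := finrank_ind_le (normalizerRep ρ U)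
  let f : Representation.IndV (normalizer ρ U).subtype (normalizerRep ρ U) →ₗ[k] V :=
    Representation.Coinvariants.lift _
      (TensorProduct.lift <| (Finsupp.lift _ _ _ fun g => ρ g⁻¹ ∘ₗ U.subtype) ∘ₗ
        (MonoidAlgebra.coeffLinearEquiv k).toLinearMap)
      (fun g => by
        ext x u
        simp [normalizerRep])
  have hf : ∀ g (u : U), f (Representation.IndV.mk _ _ g u) = ρ g⁻¹ u := by
    intro g u
    simp [f]
  have hcomm : ∀ g, f ∘ₗ Representation.ind (normalizer ρ U).subtype (normalizerRep ρ U) g =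
      ρ g ∘ₗ f := by
    intro g
    refine Representation.IndV.hom_ext _ _ fun x => LinearMap.ext fun u => ?_
    simp only [LinearMap.comp_apply]
    have h1 := Representation.ind_mk (normalizer ρ U).subtype (normalizerRep ρ U) g x u
    have h2 := hf x u
    simp only [LinearMap.comp_apply] at h1 h2
    rw [h1, h2]
    have h3 := hf (x * g⁻¹) u
    simp only [LinearMap.comp_apply] at h3
    rw [h3, mul_inv_rev, inv_inv, map_mul, Module.End.mul_apply]
  have hsurj : Function.Surjective f := by
    rw [← LinearMap.range_eq_top]
    refine (eq_bot_or_eq_top_of_isIrreducible h _ ?_).resolve_left ?_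
    · rintro g _ ⟨x, rfl⟩
      exact ⟨_, LinearMap.congr_fun (hcomm g) x⟩
    · intro h0
      obtain ⟨u, hu, hu0⟩ := U.exists_mem_ne_zero_of_ne_bot hU
      have := hf 1 ⟨u, hu⟩
      rw [LinearMap.range_eq_bot.1 h0] at this
      exact hu0 (by simpa using this.symm)
  have heq : finrank k (Representation.IndV (normalizer ρ U).subtype (normalizerRep ρ U)) =
      finrank k V :=
    le_antisymm (hdim ▸ hle) (LinearMap.finrank_le_finrank_of_surjective hsurj)
  have hinj := (LinearMap.injective_iff_surjective_of_finrank_eq_finrank heq).2 hsurj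
  exact ⟨(Representation.Equiv.mk (LinearEquiv.ofBijective f ⟨hinj, hsurj⟩) hcomm).symm⟩

end Induced

/-! ### Recognizing the Frobenius group -/

section Semidirect

/-- Two faithful modules on which the groups induce the same linear maps, up to the identification
`e`, have isomorphic semidirect products. -/
theorem nonempty_moduleSemidirect_mulEquiv {k A B X Y : Type*} [Field k] [Group A] [Group B]
    [AddCommGroup X] [AddCommGroup Y] [Module k X] [Module k Y] {σ : Representation k A X}
    {τ : Representation k B Y} (hσ : Function.Injective σ) (hτ : Function.Injective τ)
    (e : X ≃ₗ[k] Y) (h1 : ∀ a, ∃ b, ∀ x, e (σ a x) = τ b (e x))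
    (h2 : ∀ b, ∃ a, ∀ x, e (σ a x) = τ b (e x)) :
    Nonempty (ModuleSemidirect σ ≃* ModuleSemidirect τ) := by
  choose θ hθ using h1
  have huniq : ∀ a b, (∀ x, e (σ a x) = τ b (e x)) → θ a = b := by
    intro a b hab
    refine hτ (LinearMap.ext fun y => ?_)
    rw [← e.apply_symm_apply y, ← hθ, hab]
  let θ' : A →* B := MonoidHom.mk' θ fun a a' => huniq _ _ fun x => by
    rw [map_mul, map_mul, Module.End.mul_apply, Module.End.mul_apply, hθ, hθ]
  have hbij : Function.Bijective θ' := by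
    refine ⟨fun a a' haa' => hσ (LinearMap.ext fun x => e.injective ?_), fun b => ?_⟩
    · rw [hθ, hθ]
      exact congrArg (fun b => τ b (e x)) haa'
    · obtain ⟨a, ha⟩ := h2 b
      exact ⟨a, huniq a b ha⟩
  refine ⟨SemidirectProduct.congr (AddEquiv.toMultiplicative e.toAddEquiv)
    (MulEquiv.ofBijective θ' hbij) fun a => ?_⟩
  ext x
  exact hθ a x.toAdd

theorem quotientRep_injective {k G V : Type*} [Field k] [Group G] [AddCommGroup V] [Module k V]
    (ρ : Representation k G V) (W : Submodule k V) : Function.Injective (quotientRep ρ W) := by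
  intro x y hxy
  obtain ⟨g, rfl⟩ := QuotientGroup.mk_surjective x
  obtain ⟨g', rfl⟩ := QuotientGroup.mk_surjective y
  have hxy : normalizerRep ρ W g = normalizerRep ρ W g' := hxy
  rw [QuotientGroup.eq, mem_centralizerInNormalizer, map_mul, ← hxy, ← map_mul, inv_mul_cancel,
    map_one]

theorem quaternionRep_injective : Function.Injective quaternionRep := fun _ _ h =>
  quaternionToSL_injective (Subtype.ext (Matrix.toLin'.injective h))

theorem exists_quaternionToSL_eq_diagonal :
    ∀ a b : ZMod 5, a * b = 1 → ∃ q, (quaternionToSL q).1 = !![a, 0; 0, b] := by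
  decide

theorem exists_quaternionToSL_eq_antidiagonal :
    ∀ a b : ZMod 5, a * b = 1 → ∃ q, (quaternionToSL q).1 = !![0, -b; a, 0] := by
  decide

theorem quaternionToSL_eq_diagonal_or_antidiagonal :
    ∀ q, ∃ a b : ZMod 5, a * b = 1 ∧ ((quaternionToSL q).1 = !![a, 0; 0, b] ∨
      (quaternionToSL q).1 = !![0, -b; a, 0]) := by
  decide

theorem IsQuaternionPair.nonempty_moduleSemidirect_mulEquiv [Fact (Nat.Prime 5)]
    {G V : Type*} [Group G] [AddCommGroup V] [Module (ZMod 5) V] {ρ : Representation (ZMod 5) G V} {w₁ w₂ : V}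
    (h : IsQuaternionPair ρ w₁ w₂) :
    Nonempty (ModuleSemidirect (quotientRep ρ (Submodule.span (ZMod 5) {w₁, w₂})) ≃* GroupM) := by
  set W := Submodule.span (ZMod 5) {w₁, w₂} with hW
  have hw₁ : w₁ ∈ W := Submodule.subset_span (by simp)
  have hw₂ : w₂ ∈ W := Submodule.subset_span (by simp)
  let f : (Fin 2 → ZMod 5) →ₗ[ZMod 5] W :=
    (LinearMap.proj 0).smulRight ⟨w₁, hw₁⟩ + (LinearMap.proj 1).smulRight ⟨w₂, hw₂⟩
  have hf : ∀ x, (f x : V) = x 0 • w₁ + x 1 • w₂ := fun x => rfl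
  have hbij : Function.Bijective f := by
    constructor
    · rw [injective_iff_map_eq_zero]
      intro x hx
      have h0 := h.linearIndependent (x 0) (x 1) (by rw [← hf, hx]; rfl)
      ext j
      fin_cases j
      exacts [h0.1, h0.2]
    · rintro ⟨v, hv⟩
      obtain ⟨a, b, rfl⟩ := Submodule.mem_span_pair.1 hv
      exact ⟨![a, b], Subtype.ext (by simp [hf])⟩
  let e := (LinearEquiv.ofBijective f hbij).symm
  have hdiag : ∀ (g : normalizer ρ W) q a, ρ g w₁ = a • w₁ → ρ g w₂ = a⁻¹ • w₂ →
      (quaternionToSL q).1 = !![a, 0; 0, a⁻¹] →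
      ∀ x, e (quotientRep ρ W g x) = quaternionRep q (e x) := by
    intro g q a h1 h2 hq x
    obtain ⟨y, rfl⟩ := e.symm.surjective x
    rw [e.apply_symm_apply, ← e.eq_symm_apply]
    refine Subtype.ext ?_
    change ρ g (f y : V) = f (Matrix.toLin' (quaternionToSL q).1 y)
    rw [hf, hf, hq]
    simp [h1, h2, Matrix.mulVec, dotProduct, smul_smul, mul_comm]
  have hanti : ∀ (g : normalizer ρ W) q a, ρ g w₁ = a • w₂ → ρ g w₂ = -a⁻¹ • w₁ →
      (quaternionToSL q).1 = !![0, -a⁻¹; a, 0] →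
      ∀ x, e (quotientRep ρ W g x) = quaternionRep q (e x) := by
    intro g q a h1 h2 hq x
    obtain ⟨y, rfl⟩ := e.symm.surjective x
    rw [e.apply_symm_apply, ← e.eq_symm_apply]
    refine Subtype.ext ?_
    change ρ g (f y : V) = f (Matrix.toLin' (quaternionToSL q).1 y)
    rw [hf, hf, hq]
    simp [h1, h2, Matrix.mulVec, dotProduct, smul_smul, mul_comm, add_comm]
  have hmem : ∀ g, ρ g w₁ ∈ W → ρ g w₂ ∈ W → g ∈ normalizer ρ W := by
    intro g h1 h2
    have : FiniteDimensional (ZMod 5) W := Module.Finite.equiv e.symm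
    refine Submodule.eq_of_le_of_finrank_eq ?_ (finrank_map_apply ρ g W)
    rw [hW, Submodule.map_span_le]
    rintro v (rfl | rfl)
    exacts [h1, h2]
  refine RatTwo.nonempty_moduleSemidirect_mulEquiv (quotientRep_injective ρ W)
    quaternionRep_injective e (fun x => ?_) fun q => ?_
  · obtain ⟨g, rfl⟩ := QuotientGroup.mk_surjective x
    obtain ⟨a, ha, ⟨h1, h2⟩ | ⟨h1, h2⟩⟩ := h.diagonal_or_antidiagonal g g.2
    · obtain ⟨q, hq⟩ := exists_quaternionToSL_eq_diagonal a a⁻¹ (mul_inv_cancel₀ ha)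
      exact ⟨q, hdiag g q a h1 h2 hq⟩
    · obtain ⟨q, hq⟩ := exists_quaternionToSL_eq_antidiagonal a a⁻¹ (mul_inv_cancel₀ ha)
      exact ⟨q, hanti g q a h1 h2 hq⟩
  · obtain ⟨a, b, hab, hq⟩ := quaternionToSL_eq_diagonal_or_antidiagonal q
    have ha : a ≠ 0 := left_ne_zero_of_mul_eq_one hab
    obtain rfl := eq_inv_of_mul_eq_one_right hab
    rcases hq with hq | hq
    · obtain ⟨g, h1, h2⟩ := h.exists_diagonal a ha
      exact ⟨_, hdiag ⟨g, hmem g (h1 ▸ W.smul_mem _ hw₁) (h2 ▸ W.smul_mem _ hw₂)⟩ q a h1 h2 hq⟩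
    · obtain ⟨g, h1, h2⟩ := h.exists_antidiagonal a ha
      exact ⟨_, hanti ⟨g, hmem g (h1 ▸ W.smul_mem _ hw₂) (h2 ▸ W.smul_mem _ hw₁)⟩ q a h1 h2 hq⟩

theorem IsQuaternionPair.finrank_span {k G V : Type*} [Field k] [Group G] [AddCommGroup V]
    [Module k V] {ρ : Representation k G V} {w₁ w₂ : V} (h : IsQuaternionPair ρ w₁ w₂) :
    finrank k (Submodule.span k {w₁, w₂}) = 2 := by
  have hl : LinearIndependent k ![w₁, w₂] := LinearIndependent.pair_iff.2 h.linearIndependent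
  have := finrank_span_eq_card hl
  rwa [Matrix.range_cons, Matrix.range_cons, Matrix.range_empty, Set.union_empty,
    Set.singleton_union] at this

end Semidirect

end RatTwo

theorem proposition3p3 {p : ℕ} [Fact p.Prime] (hp : 5 ≤ p)
    {G V : Type*} [Group G] [Finite G] (hG2 : IsPGroup 2 G) (hGr : IsRationalGroup G)
    [AddCommGroup V] [Module (ZMod p) V] (ρ : Representation (ZMod p) G V)
    (hsimple : ρ.IsIrreducible) (heig : RatTwo.HasEigenvectorProperty ρ) :
    p = 5 ∧ ∃ W : Submodule (ZMod p) V,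
      Nonempty (RatTwo.ModuleSemidirect (RatTwo.quotientRep ρ W) ≃* RatTwo.GroupM) ∧
      Nonempty (ρ.Equiv
        (Representation.ind (RatTwo.normalizer ρ W).subtype (RatTwo.normalizerRep ρ W))) := by
  have h2 : (2 : ZMod p) ≠ 0 := by
    exact_mod_cast RatTwo.zmod_natCast_ne_zero (n := 2) (by simp) (by omega)
  obtain ⟨m, hm⟩ := hG2.exists_card_eq
  obtain ⟨n, hn⟩ := RatTwo.exists_finrank_eq_two_pow hG2 hsimple rfl
  obtain ⟨B, hB, hinv⟩ := RatTwo.exists_invariant_form hsimple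
    (by rw [hm]; push_cast; exact pow_ne_zero m h2) (by rw [hn]; push_cast; exact pow_ne_zero n h2)
    (RatTwo.isConj_inv_of_isRationalGroup hGr)
  obtain ⟨rfl, w₁, w₂, hw, hdim⟩ :=
    RatTwo.exists_isQuaternionPair hp hG2 hsimple heig hB hinv rfl
  have hne : Submodule.span (ZMod 5) {w₁, w₂} ≠ ⊥ := by
    intro e
    have := hw.finrank_span
    rw [e, finrank_bot] at this
    omega
  exact ⟨rfl, _, hw.nonempty_moduleSemidirect_mulEquiv,
    RatTwo.nonempty_equiv_ind hsimple hne (by rw [hw.finrank_span]; exact hdim)⟩
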